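/- Let $\mathbb D=\{z\in\mathbb C:|z|<1\}$ and let $\mathcal S$ be the class of functions $f$ that are analytic and univalent (injective) in $\mathbb D$ with $f(0)=0$ and $f'(0)=1$. For $g,h$ analytic in $\mathbb D$ write $g\prec h$ ($g$ is subordinate to $h$) if there is an analytic function $w:\mathbb D\to\mathbb D$ with $w(0)=0$ and $g(z)=h(w(z))$ for all $z\in\mathbb D$. The quotient $zf'(z)/f(z)$ ($f\in\mathcal S$) is given its limiting value $1$ at $z=0$. For $0\le\alpha<1$ let $\mathcal S^*_q(\alpha)$ be the class of all $f\in\mathcal S$ such that $$\operatorname{Re}\left(\frac{zf'(z)}{f(z)}\right)>\left|1+\frac{zf''(z)}{f'(z)}-\frac{zf'(z)}{f(z)}-\alpha\right|\qquad(z\in\mathbb D),$$ and let $$q_\alpha(z)=\begin{cases}\dfrac{(1-2\alpha)z}{(1-z)\left(1-(1-z)^{1-2\alpha}\right)},&\alpha\ne\tfrac12,\\[2ex]\dfrac{-z}{(1-z)\log(1-z)},&\alpha=\tfrac12,\end{cases}$$ for $z\in\mathbb D\setminus\{0\}$, with principal branches of the power and the logarithm, and $q_\alpha(0)=1$ (the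 removable singularity at $0$ is filled in). Let $\mathcal S^*(q_\alpha)$ be the class of all $f\in\mathcal S$ with $zf'(z)/f(z)\prec q_\alpha(z)$. Theorem. Let $0\le\alpha<1$. If $f\in\mathcal S^*_q(\alpha)$, then $zf'(z)/f(z)$ and $q_\alpha(z)$ are analytic in $\mathbb D$ and $$\frac{zf'(z)}{f(z)}\prec q_\alpha(z).$$ Consequently $\mathcal S^*_q(\alpha)\subseteq\mathcal S^*(q_\alpha)$. -/

import Mathlib

namespace StarlikeSubordination

/-- The open unit disk `𝔻 = {z : |z| < 1}`. -/
def unitDisk : Set ℂ := Metric.ball 0 1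

/-- The class `𝒮` of normalized univalent functions: analytic and injective on the unit disk, with
`f(z) = z + a₂ z² + ⋯`, i.e. `f(0) = 0` and `f'(0) = 1`. Only the values on the disk matter. -/
def classS : Set (ℂ → ℂ) :=
  {f | AnalyticOnNhd ℂ f unitDisk ∧ f 0 = 0 ∧ deriv f 0 = 1 ∧ Set.InjOn f unitDisk}

/-- The function `z ↦ z f'(z) / f(z)`, with the value `1` at the removable singularity `z = 0`
(its limit there, for `f` with `f(0) = 0` and `f'(0) = 1`). -/
noncomputable def logDerivQuotient (f : ℂ → ℂ) (z : ℂ) : ℂ :=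
  if z = 0 then 1 else z * deriv f z / f z

/-- A Schwarz function: an analytic self-map `w` of the unit disk with `w(0) = 0`. -/
def IsSchwarz (w : ℂ → ℂ) : Prop :=
  AnalyticOnNhd ℂ w unitDisk ∧ w 0 = 0 ∧ Set.MapsTo w unitDisk unitDisk

/-- Subordination `g ≺ h` of two analytic functions on the unit disk: `g = h ∘ w` on the disk
for some Schwarz function `w`. -/
def Subordinate (g h : ℂ → ℂ) : Prop :=
  AnalyticOnNhd ℂ g unitDisk ∧ AnalyticOnNhd ℂ h unitDisk ∧
    ∃ w : ℂ → ℂ, IsSchwarz w ∧ ∀ z ∈ unitDisk, g z = h (w z)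

/-- The class `𝒮*_q(α)`: those `f ∈ 𝒮` with
`Re (z f'(z)/f(z)) > |1 + z f''(z)/f'(z) - z f'(z)/f(z) - α|` throughout the unit disk. -/
def classSq (α : ℝ) : Set (ℂ → ℂ) :=
  {f | f ∈ classS ∧ ∀ z ∈ unitDisk,
    ‖1 + z * deriv (deriv f) z / deriv f z - logDerivQuotient f z - (α : ℂ)‖
      < (logDerivQuotient f z).re}

/-- The function `q_α`, with principal branches of the power and the logarithm, and with the value
`1` at the removable singularity `z = 0`. -/
noncomputable def q (α : ℝ) (z : ℂ) : ℂ :=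
  if z = 0 then 1
  else if α = 1 / 2 then -z / ((1 - z) * Complex.log (1 - z))
  else ((1 - 2 * α : ℝ) : ℂ) * z / ((1 - z) * (1 - (1 - z) ^ ((1 - 2 * α : ℝ) : ℂ)))

/-- The class `𝒮*(φ)`: those `f ∈ 𝒮` with `z f'(z)/f(z) ≺ φ(z)`. -/
def classStar (φ : ℂ → ℂ) : Set (ℂ → ℂ) :=
  {f | f ∈ classS ∧ Subordinate (logDerivQuotient f) φ}

end StarlikeSubordination

/-! Put p = zf'/f. Since zp'/p = 1 + zf''/f' - p, the defining inequality gives Re(p + zp'/p) > α.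
Equality in place of subordination is solved by q_α: q + zq'/q = h with h(z) = (1 + (1 - 2α)z)/(1 -
z), and Re h = α on the unit circle away from 1. The work is done with Q = 1/q_α, for which this
equation is linear. Q is analytic and univalent on Re z < 1 (`injOn_recipQ`), hence across the
circle except at 1, where Q → 0. If 1/p left Q(𝔻), then at a first exit point z₀ one would have
1/p(z₀) = Q(ζ) with |ζ| = 1, ζ ≠ 1. Applying `jack` to w = Q⁻¹(1/p) gives z₀p'/p = (1 + k)(h(ζ) - p)
with k ≥ 0, so Re(p + z₀p'/p) = α - k(Re p - α). As Re p ≥ α (`le_re_of_lt_re_add`), this is at most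
α, a contradiction. -/

namespace StarlikeSubordination

open Filter Topology

/-! ### The reciprocal Q of q_α on the half-plane -/

/-- The half-plane `Re z < 1`, which contains the closed unit disk with the point `1` removed. -/
def halfPlane : Set ℂ := {z | z.re < 1}

/-- The primitive of `(1 - z) ^ (-2α)` that vanishes at `0`, with principal branches. -/
noncomputable def powPrimitive (α : ℝ) (z : ℂ) : ℂ :=
  if α = 1 / 2 then -Complex.log (1 - z)
  else (1 - (1 - z) ^ ((1 - 2 * α : ℝ) : ℂ)) / ((1 - 2 * α : ℝ) : ℂ)

/-- The function `z / q_α(z)`, without a singularity at `0`. -/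
noncomputable def extremalRatio (α : ℝ) (z : ℂ) : ℂ := (1 - z) * powPrimitive α z

/-- The reciprocal of `q_α`, extended to the half-plane `Re z < 1`. -/
noncomputable def recipQ (α : ℝ) : ℂ → ℂ := dslope (extremalRatio α) 0

theorem isOpen_halfPlane : IsOpen halfPlane :=
  isOpen_lt Complex.continuous_re continuous_const

theorem zero_mem_halfPlane : (0 : ℂ) ∈ halfPlane := by simp [halfPlane]

theorem re_one_sub_pos {z : ℂ} (hz : z ∈ halfPlane) : 0 < (1 - z).re := by
  simpa [halfPlane] using hz

theorem one_sub_ne_zero {z : ℂ} (hz : z ∈ halfPlane) : 1 - z ≠ 0 := fun h => by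
  have := re_one_sub_pos hz
  simp [h] at this

theorem one_sub_mem_slitPlane {z : ℂ} (hz : z ∈ halfPlane) : 1 - z ∈ Complex.slitPlane :=
  Or.inl (re_one_sub_pos hz)

theorem mem_halfPlane_of_norm_le_one {z : ℂ} (hz : ‖z‖ ≤ 1) (h1 : z ≠ 1) : z ∈ halfPlane := by
  rcases lt_or_eq_of_le ((Complex.re_le_norm z).trans hz) with h | h
  · exact h
  · refine absurd ?_ h1
    have h2 : ‖z‖ ^ 2 = z.re * z.re + z.im * z.im := by
      rw [← Complex.normSq_eq_norm_sq, Complex.normSq_apply]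
    have h3 : z.im = 0 := by
      have : z.im * z.im ≤ 0 := by nlinarith [norm_nonneg z]
      exact mul_self_eq_zero.1 (le_antisymm this (mul_self_nonneg _))
    exact Complex.ext h h3

theorem unitDisk_subset_halfPlane : unitDisk ⊆ halfPlane := fun z hz => by
  have hz' : ‖z‖ < 1 := by simpa [unitDisk] using hz
  exact (Complex.re_le_norm z).trans_lt hz'

theorem smul_mem_halfPlane {z : ℂ} (hz : z ∈ halfPlane) {s : ℝ} (h0 : 0 ≤ s) (h1 : s ≤ 1) :
    (s : ℂ) * z ∈ halfPlane := by
  have hz' : z.re < 1 := hz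
  simp only [halfPlane, Set.mem_ofPred_eq, Complex.re_ofReal_mul]
  rcases h0.eq_or_lt with rfl | h
  · simp
  · nlinarith

theorem powPrimitive_zero (α : ℝ) : powPrimitive α 0 = 0 := by
  unfold powPrimitive
  split_ifs <;> simp

theorem cast_ne_zero {α : ℝ} (h : α ≠ 1 / 2) : ((1 - 2 * α : ℝ) : ℂ) ≠ 0 := by
  rw [Complex.ofReal_ne_zero]
  exact fun h' => h (by linarith)

theorem hasDerivAt_powPrimitive (α : ℝ) {z : ℂ} (hz : z ∈ halfPlane) :
    HasDerivAt (powPrimitive α) ((1 - z) ^ (-2 * α : ℂ)) z := by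
  have h1 : HasDerivAt (fun z : ℂ => 1 - z) (-1) z := by
    simpa using (hasDerivAt_id z).const_sub 1
  have hs := one_sub_mem_slitPlane hz
  by_cases h : α = 1 / 2
  · have h2 := (h1.clog hs).neg
    have : powPrimitive α = fun z => -Complex.log (1 - z) := by
      funext z
      simp [powPrimitive, h]
    rw [this]
    refine h2.congr_deriv ?_
    rw [h]
    have : (-2 * ((1 / 2 : ℝ) : ℂ)) = -1 := by push_cast; ring
    rw [this, Complex.cpow_neg_one]
    field_simp
  · have h2 := ((h1.cpow_const (c := ((1 - 2 * α : ℝ) : ℂ)) hs).const_sub 1).div_const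
      ((1 - 2 * α : ℝ) : ℂ)
    have : powPrimitive α = fun z =>
        (1 - (1 - z) ^ ((1 - 2 * α : ℝ) : ℂ)) / ((1 - 2 * α : ℝ) : ℂ) := by
      funext z
      rw [powPrimitive, if_neg h]
    rw [this]
    refine h2.congr_deriv ?_
    have h3 : ((1 - 2 * α : ℝ) : ℂ) - 1 = -2 * α := by push_cast; ring
    rw [h3, mul_neg_one, neg_neg, mul_div_cancel_left₀ _ (cast_ne_zero h)]

/-- Eliminates the power in favour of the primitive, so that later computations need no separate
case α = 1/2. -/
theorem one_sub_mul_cpow (α : ℝ) {z : ℂ} (hz : z ∈ halfPlane) :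
    (1 - z) * (1 - z) ^ (-2 * α : ℂ) = 1 - (1 - 2 * α) * powPrimitive α z := by
  by_cases h : α = 1 / 2
  · rw [h]
    have : (-2 * ((1 / 2 : ℝ) : ℂ)) = -1 := by push_cast; ring
    rw [this, Complex.cpow_neg_one, mul_inv_cancel₀ (one_sub_ne_zero hz)]
    push_cast
    ring
  · have h3 : ((1 - 2 * α : ℝ) : ℂ) = 1 + -2 * α := by push_cast; ring
    have h4 := cast_ne_zero h
    have h5 : (1 - z) * (1 - z) ^ (-2 * α : ℂ) = (1 - z) ^ ((1 - 2 * α : ℝ) : ℂ) := by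
      rw [h3, Complex.cpow_add _ _ (one_sub_ne_zero hz), Complex.cpow_one]
    rw [h5, powPrimitive, if_neg h]
    have h6 : (1 - 2 * (α : ℂ)) = ((1 - 2 * α : ℝ) : ℂ) := by push_cast; ring
    rw [h6, mul_div_cancel₀ _ h4]
    ring

/-- A zero would give (1 - 2α) log(1 - z) = 2πin. The left side has imaginary part at most π in
modulus because |1 - 2α| ≤ 1, so n = 0 and log(1 - z) = 0. -/
theorem powPrimitive_ne_zero {α : ℝ} (hα0 : 0 ≤ α) (hα1 : α < 1) {z : ℂ} (hz : z ∈ halfPlane)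
    (h0 : z ≠ 0) : powPrimitive α z ≠ 0 := by
  have hlog : Complex.log (1 - z) ≠ 0 := fun h => by
    have := Complex.exp_log (one_sub_ne_zero hz)
    rw [h, Complex.exp_zero] at this
    exact h0 (by linear_combination this)
  unfold powPrimitive
  split_ifs with h
  · exact neg_ne_zero.2 hlog
  · refine div_ne_zero (fun h1 => ?_) (cast_ne_zero h)
    rw [sub_eq_zero, eq_comm, Complex.cpow_def_of_ne_zero (one_sub_ne_zero hz),
      Complex.exp_eq_one_iff] at h1
    obtain ⟨n, hn⟩ := h1
    have him := congrArg Complex.im hn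
    have hre := congrArg Complex.re hn
    simp only [Complex.mul_im, Complex.mul_re, Complex.ofReal_re, Complex.ofReal_im, mul_zero,
      zero_add, sub_zero, Complex.intCast_re, Complex.intCast_im, Complex.re_ofNat,
      Complex.im_ofNat, Complex.I_re, Complex.I_im, zero_mul, mul_one, add_zero,
      Complex.log_im, sub_self] at him hre
    have hb : |1 - 2 * α| ≤ 1 := abs_le.2 ⟨by linarith, by linarith⟩
    have hn0 : n = 0 := by
      by_contra hne
      have h2 : (1 : ℝ) ≤ |(n : ℝ)| := by exact_mod_cast Int.one_le_abs hne
      have h3 := Complex.abs_arg_le_pi (1 - z)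
      have h4 : |Complex.arg (1 - z) * (1 - 2 * α)| ≤ Real.pi := by
        rw [abs_mul]
        nlinarith [abs_nonneg (1 - 2 * α), abs_nonneg (Complex.arg (1 - z))]
      rw [him, abs_mul, abs_of_pos (by positivity : 0 < 2 * Real.pi)] at h4
      nlinarith [Real.pi_pos]
    rw [hn0] at hn
    simp only [Int.cast_zero, zero_mul] at hn
    exact (mul_ne_zero hlog (cast_ne_zero h)) hn

theorem hasDerivAt_extremalRatio (α : ℝ) {z : ℂ} (hz : z ∈ halfPlane) :
    HasDerivAt (extremalRatio α) (1 - (2 - 2 * α) * powPrimitive α z) z := by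
  have h1 : HasDerivAt (fun z : ℂ => 1 - z) (-1) z := by
    simpa using (hasDerivAt_id z).const_sub 1
  refine (h1.mul (hasDerivAt_powPrimitive α hz)).congr_deriv ?_
  rw [one_sub_mul_cpow α hz]
  ring

theorem extremalRatio_zero (α : ℝ) : extremalRatio α 0 = 0 := by
  simp [extremalRatio, powPrimitive_zero]

theorem mul_recipQ (α : ℝ) (z : ℂ) : z * recipQ α z = extremalRatio α z := by
  simpa [extremalRatio_zero, recipQ] using sub_smul_dslope (extremalRatio α) 0 z

theorem recipQ_zero (α : ℝ) : recipQ α 0 = 1 := by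
  simp [recipQ, (hasDerivAt_extremalRatio α zero_mem_halfPlane).deriv, powPrimitive_zero]

theorem differentiableOn_recipQ (α : ℝ) : DifferentiableOn ℂ (recipQ α) halfPlane :=
  (Complex.differentiableOn_dslope (isOpen_halfPlane.mem_nhds zero_mem_halfPlane)).2
    fun _ hz => (hasDerivAt_extremalRatio α hz).differentiableAt.differentiableWithinAt

theorem analyticOnNhd_recipQ (α : ℝ) : AnalyticOnNhd ℂ (recipQ α) halfPlane :=
  (differentiableOn_recipQ α).analyticOnNhd isOpen_halfPlane

theorem recipQ_ne_zero {α : ℝ} (hα0 : 0 ≤ α) (hα1 : α < 1) {z : ℂ} (hz : z ∈ halfPlane) :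
    recipQ α z ≠ 0 := by
  by_cases h0 : z = 0
  · simp [h0, recipQ_zero]
  · intro h
    have := mul_recipQ α z
    rw [h, mul_zero, extremalRatio] at this
    exact mul_ne_zero (one_sub_ne_zero hz) (powPrimitive_ne_zero hα0 hα1 hz h0) this.symm

theorem q_eq_inv_recipQ (α : ℝ) (z : ℂ) : q α z = (recipQ α z)⁻¹ := by
  by_cases h0 : z = 0
  · simp [h0, recipQ_zero, q]
  · have h1 : recipQ α z = extremalRatio α z / z := by
      rw [← mul_recipQ, mul_div_cancel_left₀ _ h0]
    rw [h1, inv_div, q, if_neg h0, extremalRatio, powPrimitive]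
    split_ifs with h
    · rw [mul_neg, div_neg, neg_div]
    · rw [← mul_div_assoc, div_div_eq_mul_div, mul_comm]

/-! ### The differential equation for Q -/

/-- The first-order equation `Q + z Q' = A'` for `z Q(z) = A(z)`. -/
theorem recipQ_add_mul_deriv (α : ℝ) {z : ℂ} (hz : z ∈ halfPlane) :
    recipQ α z + z * deriv (recipQ α) z = 1 - (2 - 2 * α) * powPrimitive α z := by
  have h1 := (hasDerivAt_id z).mul (analyticOnNhd_recipQ α z hz).differentiableAt.hasDerivAt
  have h2 : (id * recipQ α) = extremalRatio α := by
    funext w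
    simpa using mul_recipQ α w
  rw [h2] at h1
  simpa using h1.unique (hasDerivAt_extremalRatio α hz)

theorem deriv_recipQ_zero (α : ℝ) : 2 * deriv (recipQ α) 0 = -(2 - 2 * α) := by
  have hQ := analyticOnNhd_recipQ α 0 zero_mem_halfPlane
  have h1 := hQ.differentiableAt.hasDerivAt.add
    ((hasDerivAt_id 0).mul hQ.deriv.differentiableAt.hasDerivAt)
  have h2 := ((hasDerivAt_powPrimitive α zero_mem_halfPlane).const_mul (2 - 2 * (α : ℂ))).const_sub 1
  have h3 : (recipQ α + id * deriv (recipQ α)) =ᶠ[𝓝 0]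
      fun z => 1 - (2 - 2 * (α : ℂ)) * powPrimitive α z := by
    filter_upwards [isOpen_halfPlane.mem_nhds zero_mem_halfPlane] with z hz
    simpa using recipQ_add_mul_deriv α hz
  have h4 := h1.unique (h2.congr_of_eventuallyEq h3)
  simp at h4
  linear_combination h4

/-! ### Sign of Re((1 - z)Q') and univalence of Q -/

theorem arg_eq_arctan_of_re_pos {z : ℂ} (hz : 0 < z.re) :
    Complex.arg z = Real.arctan (z.im / z.re) := by
  have h := abs_lt.1 (Complex.abs_arg_lt_pi_div_two_iff.2 (Or.inl hz))
  rw [← Complex.tan_arg, Real.arctan_tan h.1 h.2]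

/-- The argument moves monotonically from `0` to `arg (1 - z)` as `s` runs from `0` to `1`. -/
theorem re_one_sub_mul_cpow_pos {α : ℝ} (hα0 : 0 ≤ α) (hα1 : α < 1) {z : ℂ} (hz : z ∈ halfPlane)
    {s : ℝ} (h0 : 0 ≤ s) (h1 : s ≤ 1) :
    0 < ((1 - z) * (1 - s * z) ^ (-2 * α : ℂ)).re := by
  have hsz := smul_mem_halfPlane hz h0 h1
  have hv := re_one_sub_pos hz
  have hvs := re_one_sub_pos hsz
  have key : (1 - z) * (1 - s * z) ^ (-2 * α : ℂ) =
      Complex.exp (Complex.log (1 - z) + Complex.log (1 - s * z) * (-2 * α : ℂ)) := by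
    rw [Complex.exp_add, Complex.exp_log (one_sub_ne_zero hz),
      Complex.cpow_def_of_ne_zero (one_sub_ne_zero hsz)]
  have him : (Complex.log (1 - z) + Complex.log (1 - s * z) * (-2 * α : ℂ)).im =
      Complex.arg (1 - z) - 2 * α * Complex.arg (1 - s * z) := by
    simp [Complex.log_im]
    ring
  rw [key, Complex.exp_re, him]
  refine mul_pos (Real.exp_pos _) ?_
  have hpi := abs_lt.1 (Complex.abs_arg_lt_pi_div_two_iff.2 (Or.inl hv))
  have hres : (1 - s * z).re = 1 - s * z.re := by simp
  have hims : (1 - s * z).im = -(s * z.im) := by simp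
  have hre : (1 - z).re = 1 - z.re := by simp
  have him' : (1 - z).im = -z.im := by simp
  rw [hres] at hvs
  rw [hre] at hv
  have hA := arg_eq_arctan_of_re_pos (re_one_sub_pos hz)
  have hB := arg_eq_arctan_of_re_pos (re_one_sub_pos hsz)
  rw [hre, him'] at hA
  rw [hres, hims] at hB
  have hs : s * (1 - z.re) ≤ 1 - s * z.re := by nlinarith
  rw [← Real.cos_neg]
  -- With arg(1 - sz) between 0 and arg(1 - z), and 0 ≤ 2α < 2, the angle arg(1 - z) - 2α arg(1 -
  -- sz) lies between ±arg(1 - z), hence in (-π/2, π/2).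
  rcases le_total 0 z.im with h | h
  · have hc1 : Complex.arg (1 - s * z) ≤ 0 := by
      rw [hB, Real.arctan_le_zero]
      exact div_nonpos_of_nonpos_of_nonneg (by nlinarith) hvs.le
    have hc2 : Complex.arg (1 - z) ≤ Complex.arg (1 - s * z) := by
      rw [hA, hB, Real.arctan_le_arctan_iff, div_le_div_iff₀ hv hvs]
      nlinarith
    exact Real.cos_pos_of_mem_Ioo ⟨by nlinarith, by nlinarith⟩
  · have hc1 : 0 ≤ Complex.arg (1 - s * z) := by
      rw [hB, Real.arctan_nonneg]
      exact div_nonneg (by nlinarith) hvs.le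
    have hc2 : Complex.arg (1 - s * z) ≤ Complex.arg (1 - z) := by
      rw [hA, hB, Real.arctan_le_arctan_iff, div_le_div_iff₀ hvs hv]
      nlinarith
    exact Real.cos_pos_of_mem_Ioo ⟨by nlinarith, by nlinarith⟩

/-- With A = zQ and N = zA' - A one has z²Q' = N and N' = zA''. Following N along the segment from 0
to z amounts to (1 - z)Q'(z) = -(2 - 2α)∫₀¹ s(1 - z)(1 - sz)^(-2α) ds, whose integrand has positive
real part for 0 < s ≤ 1. -/
theorem re_one_sub_mul_deriv_recipQ_neg {α : ℝ} (hα0 : 0 ≤ α) (hα1 : α < 1) {z : ℂ}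
    (hz : z ∈ halfPlane) : ((1 - z) * deriv (recipQ α) z).re < 0 := by
  by_cases hz0 : z = 0
  · have h := congrArg Complex.re (deriv_recipQ_zero α)
    simp at h
    simp [hz0]
    linarith
  have hN : ∀ w ∈ halfPlane, HasDerivAt
      (fun w => w * (1 - (2 - 2 * α) * powPrimitive α w) - extremalRatio α w)
      (-(2 - 2 * α) * w * (1 - w) ^ (-2 * α : ℂ)) w := fun w hw => by
    refine (((hasDerivAt_id w).mul (((hasDerivAt_powPrimitive α hw).const_mul
      (2 - 2 * (α : ℂ))).const_sub 1)).sub (hasDerivAt_extremalRatio α hw)).congr_deriv ?_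
    simp only [id]
    ring
  set N : ℂ → ℂ := fun w => w * (1 - (2 - 2 * α) * powPrimitive α w) - extremalRatio α w
  have hQ : (1 - z) * deriv (recipQ α) z = (1 - z) / z ^ 2 * N ((1 : ℝ) * z) := by
    have h1 := recipQ_add_mul_deriv α hz
    have h2 := mul_recipQ α z
    have h3 : N ((1 : ℝ) * z) = z ^ 2 * deriv (recipQ α) z := by
      simp only [N, Complex.ofReal_one, one_mul]
      linear_combination (-z) * h1 + h2
    rw [h3]
    field_simp
  have hφ : ∀ s ∈ Set.Icc (0 : ℝ) 1, HasDerivAt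
      (fun s : ℝ => ((1 - z) / z ^ 2 * N (s * z)).re)
      (-(2 - 2 * α) * s * ((1 - z) * (1 - s * z) ^ (-2 * α : ℂ)).re) s := fun s hs => by
    have h1 : HasDerivAt (fun s : ℝ => (s : ℂ) * z) z s := by
      simpa using (Complex.ofRealCLM.hasDerivAt (x := s)).mul_const z
    have h2 := ((hN _ (smul_mem_halfPlane hz hs.1 hs.2)).comp s h1).const_mul ((1 - z) / z ^ 2)
    have h3 := Complex.reCLM.hasFDerivAt.comp_hasDerivAt s h2
    refine h3.congr_deriv ?_
    have h4 : (1 - z) / z ^ 2 * (-(2 - 2 * α) * (s * z) * (1 - s * z) ^ (-2 * α : ℂ) * z) =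
        ((-(2 - 2 * α) * s : ℝ) : ℂ) * ((1 - z) * (1 - s * z) ^ (-2 * α : ℂ)) := by
      push_cast
      field_simp
    rw [h4, Complex.reCLM_apply, Complex.re_ofReal_mul]
  have hanti : StrictAntiOn (fun s : ℝ => ((1 - z) / z ^ 2 * N (s * z)).re) (Set.Icc 0 1) := by
    refine strictAntiOn_of_deriv_neg (convex_Icc 0 1)
      (fun s hs => (hφ s hs).continuousAt.continuousWithinAt) fun s hs => ?_
    rw [interior_Icc] at hs
    rw [(hφ s ⟨hs.1.le, hs.2.le⟩).deriv]
    have := re_one_sub_mul_cpow_pos hα0 hα1 hz hs.1.le hs.2.le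
    have h2 : 0 < (2 - 2 * α) * s := mul_pos (by linarith) hs.1
    nlinarith
  have h := hanti (Set.left_mem_Icc.2 zero_le_one) (Set.right_mem_Icc.2 zero_le_one) one_pos
  rw [hQ]
  refine h.trans_eq ?_
  simp [N, extremalRatio_zero]

theorem deriv_recipQ_ne_zero {α : ℝ} (hα0 : 0 ≤ α) (hα1 : α < 1) {z : ℂ} (hz : z ∈ halfPlane) :
    deriv (recipQ α) z ≠ 0 := fun h => by
  simpa [h] using re_one_sub_mul_deriv_recipQ_neg hα0 hα1 hz

/-- `Q` is univalent in the half-plane: in the variable `log (1 - z)`, which ranges over a strip,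
its derivative has positive real part. -/
theorem injOn_recipQ {α : ℝ} (hα0 : 0 ≤ α) (hα1 : α < 1) : Set.InjOn (recipQ α) halfPlane := by
  intro z₁ hz₁ z₂ hz₂ heq
  by_contra hne
  set u₁ := Complex.log (1 - z₁)
  set u₂ := Complex.log (1 - z₂)
  have he₁ : Complex.exp u₁ = 1 - z₁ := Complex.exp_log (one_sub_ne_zero hz₁)
  have he₂ : Complex.exp u₂ = 1 - z₂ := Complex.exp_log (one_sub_ne_zero hz₂)
  have hu : u₂ - u₁ ≠ 0 := fun h => by
    rw [sub_eq_zero] at h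
    rw [← h, he₂] at he₁
    exact hne (by linear_combination he₁)
  -- The strip |Im u| < π/2 is convex, so the segment from u₁ to u₂ stays in it.
  have hmem : ∀ t ∈ Set.Icc (0 : ℝ) 1,
      1 - Complex.exp (u₁ + t * (u₂ - u₁)) ∈ halfPlane := fun t ht => by
    have hb₁ := abs_lt.1 (Complex.abs_arg_lt_pi_div_two_iff.2 (Or.inl (re_one_sub_pos hz₁)))
    have hb₂ := abs_lt.1 (Complex.abs_arg_lt_pi_div_two_iff.2 (Or.inl (re_one_sub_pos hz₂)))
    have him : (u₁ + t * (u₂ - u₁)).im =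
        (1 - t) * Complex.arg (1 - z₁) + t * Complex.arg (1 - z₂) := by
      simp [u₁, u₂, Complex.log_im]
      ring
    have hcos : 0 < Real.cos (u₁ + t * (u₂ - u₁)).im := by
      rw [him]
      have h1 : 0 ≤ 1 - t := by linarith [ht.2]
      have h2 := ht.1
      refine Real.cos_pos_of_mem_Ioo ⟨?_, ?_⟩
      · rcases h2.eq_or_lt with h | h
        · subst h; linarith
        · nlinarith [mul_lt_mul_of_pos_left hb₂.1 h, mul_le_mul_of_nonneg_left hb₁.1.le h1]
      · rcases h2.eq_or_lt with h | h
        · subst h; linarith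
        · nlinarith [mul_lt_mul_of_pos_left hb₂.2 h, mul_le_mul_of_nonneg_left hb₁.2.le h1]
    have : 0 < (Complex.exp (u₁ + t * (u₂ - u₁))).re := by
      rw [Complex.exp_re]
      exact mul_pos (Real.exp_pos _) hcos
    simp only [halfPlane, Set.mem_ofPred_eq, Complex.sub_re, Complex.one_re]
    linarith
  -- Dividing by u₂ - u₁ leaves d/du Q(1 - e^u) = -(1 - z)Q'(z) at z = 1 - e^u, so the real part
  -- strictly increases and the endpoint values differ.
  have hφ : ∀ t ∈ Set.Icc (0 : ℝ) 1, HasDerivAt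
      (fun t : ℝ => (recipQ α (1 - Complex.exp (u₁ + t * (u₂ - u₁))) / (u₂ - u₁)).re)
      (-((1 - (1 - Complex.exp (u₁ + t * (u₂ - u₁)))) *
        deriv (recipQ α) (1 - Complex.exp (u₁ + t * (u₂ - u₁)))).re) t := fun t ht => by
    have h1 : HasDerivAt (fun t : ℝ => u₁ + (t : ℂ) * (u₂ - u₁)) (u₂ - u₁) t := by
      simpa using ((Complex.ofRealCLM.hasDerivAt (x := t)).mul_const (u₂ - u₁)).const_add u₁
    have h2 := h1.cexp.const_sub 1
    have h3 := ((analyticOnNhd_recipQ α _ (hmem t ht)).differentiableAt.hasDerivAt.comp t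
      h2).div_const (u₂ - u₁)
    refine (Complex.reCLM.hasFDerivAt.comp_hasDerivAt t h3).congr_deriv ?_
    rw [Complex.reCLM_apply, ← Complex.neg_re]
    congr 1
    field_simp
    ring
  have hmono : StrictMonoOn (fun t : ℝ =>
      (recipQ α (1 - Complex.exp (u₁ + t * (u₂ - u₁))) / (u₂ - u₁)).re) (Set.Icc 0 1) := by
    refine strictMonoOn_of_deriv_pos (convex_Icc 0 1)
      (fun s hs => (hφ s hs).continuousAt.continuousWithinAt) fun s hs => ?_
    have hs' := interior_subset hs
    rw [(hφ s hs').deriv]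
    linarith [re_one_sub_mul_deriv_recipQ_neg hα0 hα1 (hmem s hs')]
  have h := hmono (Set.left_mem_Icc.2 zero_le_one) (Set.right_mem_Icc.2 zero_le_one) one_pos
  simp [he₁, he₂, heq] at h

/-! ### Boundary values of Q -/

/-- With v = 1 - z the terms are v and v log v, or v and v^(2 - 2α), the exponent being positive
because α < 1. -/
theorem tendsto_extremalRatio_one {α : ℝ} (hα1 : α < 1) :
    Tendsto (extremalRatio α) (𝓝[≠] 1) (𝓝 0) := by
  have hsub : Tendsto (fun z : ℂ => 1 - z) (𝓝[≠] 1) (𝓝 0) := by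
    have : ContinuousAt (fun z : ℂ => 1 - z) 1 := by fun_prop
    simpa using this.tendsto.mono_left nhdsWithin_le_nhds
  by_cases h : α = 1 / 2
  · have hlog : Tendsto (fun v : ℂ => v * Complex.log v) (𝓝 0) (𝓝 0) := by
      have h1 : Tendsto (fun v : ℂ => |‖v‖ * Real.log ‖v‖| + ‖v‖ * Real.pi) (𝓝 0) (𝓝 0) := by
        have : Continuous fun v : ℂ => |‖v‖ * Real.log ‖v‖| + ‖v‖ * Real.pi :=
          (Real.continuous_mul_log.comp continuous_norm).abs.add (by fun_prop)
        simpa using this.tendsto 0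
      refine squeeze_zero_norm (fun v => ?_) h1
      rw [norm_mul, abs_mul, abs_norm, ← mul_add]
      refine mul_le_mul_of_nonneg_left ?_ (norm_nonneg _)
      refine (Complex.norm_le_abs_re_add_abs_im _).trans ?_
      rw [Complex.log_re, Complex.log_im]
      linarith [Complex.abs_arg_le_pi v]
    have h2 := (hlog.comp hsub).neg
    rw [neg_zero] at h2
    refine h2.congr fun z => ?_
    simp only [Function.comp, extremalRatio, powPrimitive, if_pos h]
    ring
  · have hc : 0 < (1 + ((1 - 2 * α : ℝ) : ℂ)).re := by
      rw [Complex.add_re, Complex.one_re, Complex.ofReal_re]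
      linarith
    have hpow : Tendsto (fun v : ℂ => v ^ (1 + ((1 - 2 * α : ℝ) : ℂ))) (𝓝 0) (𝓝 0) := by
      have h1 := (Complex.continuousAt_cpow_zero_of_re_pos hc).tendsto.comp
        ((continuous_id.prodMk continuous_const).tendsto (0 : ℂ))
      rw [Complex.zero_cpow (ne_of_apply_ne Complex.re hc.ne')] at h1
      exact h1
    have h2 := (hsub.sub (hpow.comp hsub)).div_const ((1 - 2 * α : ℝ) : ℂ)
    rw [sub_zero, zero_div] at h2
    refine h2.congr' ?_
    filter_upwards [self_mem_nhdsWithin] with z hz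
    have hz' : 1 - z ≠ 0 := sub_ne_zero.2 (Ne.symm hz)
    rw [extremalRatio, powPrimitive, if_neg h, Function.comp, Complex.cpow_add _ _ hz',
      Complex.cpow_one]
    ring

theorem tendsto_recipQ_one {α : ℝ} (hα1 : α < 1) :
    Tendsto (recipQ α) (𝓝[≠] 1) (𝓝 0) := by
  have h1 : Tendsto (fun z : ℂ => z) (𝓝[≠] 1) (𝓝 1) := tendsto_id.mono_left nhdsWithin_le_nhds
  have h2 := (tendsto_extremalRatio_one hα1).div h1 one_ne_zero
  rw [zero_div] at h2
  refine h2.congr' ?_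
  filter_upwards [h1.eventually_ne one_ne_zero] with z hz
  simp only [Pi.div_apply]
  rw [← mul_recipQ, mul_div_cancel_left₀ _ hz]

/-- A nonzero boundary value of `Q(𝔻)` is attained on the closed disk, away from the point `1`. -/
theorem exists_recipQ_eq_of_mem_closure {α : ℝ} (hα1 : α < 1) {y : ℂ}
    (hy : y ∈ closure (recipQ α '' unitDisk)) (hy0 : y ≠ 0) :
    ∃ ζ ∈ halfPlane, ‖ζ‖ ≤ 1 ∧ recipQ α ζ = y := by
  obtain ⟨x, hx, hxy⟩ := mem_closure_iff_seq_limit.1 hy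
  choose w hw hwx using hx
  have hw1 : ∀ n, w n ∈ Metric.closedBall (0 : ℂ) 1 := fun n => Metric.ball_subset_closedBall (hw n)
  obtain ⟨ζ, hζ, φ, hφ, hlim⟩ := (isCompact_closedBall (0 : ℂ) 1).tendsto_subseq hw1
  have hζ' : ‖ζ‖ ≤ 1 := by simpa using hζ
  have hQ : Tendsto (fun n => recipQ α (w (φ n))) atTop (𝓝 y) := by
    simp only [hwx]
    exact hxy.comp hφ.tendsto_atTop
  have h1 : ζ ≠ 1 := by
    rintro rfl
    refine hy0 (tendsto_nhds_unique hQ ((tendsto_recipQ_one hα1).comp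
      (tendsto_nhdsWithin_iff.2 ⟨hlim, Eventually.of_forall fun n h => ?_⟩)))
    have h2 := hw (φ n)
    have h3 : w (φ n) = 1 := h
    simp [h3, unitDisk] at h2
  have hH := mem_halfPlane_of_norm_le_one hζ' h1
  exact ⟨ζ, hH, hζ', tendsto_nhds_unique
    ((analyticOnNhd_recipQ α ζ hH).continuousAt.tendsto.comp hlim) hQ⟩

/-! ### The inverse of Q and openness of Q(𝔻) -/

/-- The inverse of `Q` on the image of the half-plane. -/
noncomputable def recipQInv (α : ℝ) : ℂ → ℂ := Function.invFunOn (recipQ α) halfPlane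

theorem recipQInv_recipQ {α : ℝ} (hα0 : 0 ≤ α) (hα1 : α < 1) {z : ℂ} (hz : z ∈ halfPlane) :
    recipQInv α (recipQ α z) = z :=
  (injOn_recipQ hα0 hα1).leftInvOn_invFunOn hz

theorem recipQInv_one {α : ℝ} (hα0 : 0 ≤ α) (hα1 : α < 1) : recipQInv α 1 = 0 := by
  rw [← recipQ_zero α, recipQInv_recipQ hα0 hα1 zero_mem_halfPlane]

theorem hasDerivAt_recipQInv {α : ℝ} (hα0 : 0 ≤ α) (hα1 : α < 1) {z : ℂ} (hz : z ∈ halfPlane) :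
    HasDerivAt (recipQInv α) (deriv (recipQ α) z)⁻¹ (recipQ α z) := by
  refine ((analyticOnNhd_recipQ α z hz).hasStrictDerivAt.to_local_left_inverse
    (deriv_recipQ_ne_zero hα0 hα1 hz) ?_).hasDerivAt
  filter_upwards [isOpen_halfPlane.mem_nhds hz] with w hw
  exact recipQInv_recipQ hα0 hα1 hw

theorem isOpen_recipQ_image {α : ℝ} (hα0 : 0 ≤ α) (hα1 : α < 1) :
    IsOpen (recipQ α '' unitDisk) := by
  rw [isOpen_iff_mem_nhds]
  rintro _ ⟨z, hz, rfl⟩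
  have hz' := unitDisk_subset_halfPlane hz
  rw [← (analyticOnNhd_recipQ α z hz').hasStrictDerivAt.map_nhds_eq
    (deriv_recipQ_ne_zero hα0 hα1 hz')]
  exact image_mem_map (Metric.isOpen_ball.mem_nhds hz)

/-! ### First-order conditions at extremal points, and Jack's lemma -/

/-- If `Re F` is at least `Re F(z₀)` on the disk `|z| < |z₀|`, then `z₀ F'(z₀)` is real and
nonpositive. -/
theorem mul_deriv_of_re_min {F : ℂ → ℂ} {F' z₀ : ℂ} (hF : HasDerivAt F F' z₀)
    (hmin : ∀ z, ‖z‖ < ‖z₀‖ → (F z₀).re ≤ (F z).re) :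
    (z₀ * F').im = 0 ∧ (z₀ * F').re ≤ 0 := by
  by_cases hz₀ : z₀ = 0
  · simp [hz₀]
  -- For Re c < 0 the spiral t ↦ z₀e^(tc) enters the disk |z| < |z₀|, so the right derivative of Re
  -- F along it at t = 0 is nonnegative.
  have key : ∀ c : ℂ, c.re < 0 → 0 ≤ (c * (z₀ * F')).re := fun c hc => by
    have h1 : HasDerivAt (fun t : ℝ => z₀ * Complex.exp (t * c)) (z₀ * c) (0 : ℝ) := by
      have := (((Complex.ofRealCLM.hasDerivAt (x := 0)).mul_const c).cexp).const_mul z₀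
      simpa using this
    have h2 : HasDerivAt F F' (z₀ * Complex.exp ((0 : ℝ) * c)) := by simpa using hF
    have h3 := Complex.reCLM.hasFDerivAt.comp_hasDerivAt (0 : ℝ) (h2.comp (0 : ℝ) h1)
    have h4 := h3.hasDerivWithinAt (s := Set.Ioi 0)
    rw [hasDerivWithinAt_iff_tendsto_slope' (by simp)] at h4
    have h5 : 0 ≤ Complex.reCLM (F' * (z₀ * c)) := by
      refine ge_of_tendsto h4 ?_
      filter_upwards [self_mem_nhdsWithin] with t ht
      have ht' : 0 < t := ht
      have h6 : ‖z₀ * Complex.exp (t * c)‖ < ‖z₀‖ := by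
        rw [norm_mul, Complex.norm_exp, Complex.re_ofReal_mul]
        exact mul_lt_of_lt_one_right (norm_pos_iff.2 hz₀)
          (Real.exp_lt_one_iff.2 (mul_neg_of_pos_of_neg ht' hc))
      have h7 := hmin _ h6
      rw [slope_def_field]
      refine div_nonneg ?_ (by linarith)
      simpa using h7
    have h8 : c * (z₀ * F') = F' * (z₀ * c) := by ring
    rwa [h8]
  -- Take c = -1 + is. As s is arbitrary, the imaginary part must vanish; the value of s chosen
  -- below would make the expression -1.
  have key' : ∀ s : ℝ, 0 ≤ -(z₀ * F').re - s * (z₀ * F').im := fun s => by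
    simpa using key ⟨-1, s⟩ (by simp)
  set A := z₀ * F'
  have him : A.im = 0 := by
    by_contra h
    have := key' ((1 - A.re) / A.im)
    rw [div_mul_cancel₀ _ h] at this
    linarith
  have := key' 0
  exact ⟨him, by linarith⟩

/-- At a minimum z₀ of Re p on a closed disk, z₀p' is real and nonpositive; as Re p > 0, Re(z₀p'/p)
≤ 0 and so α < Re p(z₀). -/
theorem le_re_of_lt_re_add {α : ℝ} {p : ℂ → ℂ} (hp : AnalyticOnNhd ℂ p unitDisk)
    (hpos : ∀ z ∈ unitDisk, 0 < (p z).re)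
    (hH : ∀ z ∈ unitDisk, α < (p z + z * deriv p z / p z).re) {z : ℂ} (hz : z ∈ unitDisk) :
    α ≤ (p z).re := by
  have hz' : ‖z‖ < 1 := by simpa [unitDisk] using hz
  have hsub : Metric.closedBall (0 : ℂ) ‖z‖ ⊆ unitDisk := Metric.closedBall_subset_ball hz'
  obtain ⟨z₀, hz₀, hmin⟩ := (isCompact_closedBall (0 : ℂ) ‖z‖).exists_isMinOn ⟨z, by simp⟩
    (Complex.continuous_re.comp_continuousOn (hp.continuousOn.mono hsub))
  have hz₀' := hsub hz₀
  have hn : ‖z₀‖ ≤ ‖z‖ := by simpa using hz₀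
  obtain ⟨him, hre⟩ := mul_deriv_of_re_min (hp z₀ hz₀').differentiableAt.hasDerivAt
    fun w hw => hmin (by simpa using hw.le.trans hn)
  refine le_trans ?_ (hmin (by simp : z ∈ Metric.closedBall (0 : ℂ) ‖z‖))
  have h1 := hH z₀ hz₀'
  rw [Complex.add_re, Complex.div_re, him, zero_mul, zero_div, add_zero] at h1
  have h2 : (z₀ * deriv p z₀).re * (p z₀).re / Complex.normSq (p z₀) ≤ 0 :=
    div_nonpos_of_nonpos_of_nonneg (mul_nonpos_of_nonpos_of_nonneg hre (hpos z₀ hz₀').le)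
      (Complex.normSq_nonneg _)
  simp only [Function.comp]
  linarith

/-- **Jack's lemma**: at a point `z₀` where `|w|` first reaches `1`, the quotient
`z₀ w'(z₀) / w(z₀)` is real and at least `1`. -/
theorem jack {w : ℂ → ℂ} {w' z₀ : ℂ} (hw : DifferentiableOn ℂ w (Metric.ball 0 ‖z₀‖))
    (hw0 : w 0 = 0) (hmaps : Set.MapsTo w (Metric.ball 0 ‖z₀‖) (Metric.ball 0 1))
    (hw' : HasDerivAt w w' z₀) (h1 : ‖w z₀‖ = 1) :
    ∃ k : ℝ, 0 ≤ k ∧ z₀ * w' = (1 + k) * w z₀ := by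
  have hz₀ : z₀ ≠ 0 := by
    rintro rfl
    simp [hw0] at h1
  have hζ : w z₀ ≠ 0 := norm_ne_zero_iff.1 (by rw [h1]; exact one_ne_zero)
  -- Take F(z) = -(w(z)/z)(z₀/w(z₀)). The Schwarz lemma gives |F| ≤ 1, while F(z₀) = -1, so Re F is
  -- minimal at z₀.
  have hF := (((hw'.div (hasDerivAt_id z₀) hz₀).mul_const (z₀ / w z₀)).neg)
  have hval : -(w z₀ / z₀ * (z₀ / w z₀)) = -1 := by field_simp
  obtain ⟨him, hre⟩ := mul_deriv_of_re_min hF fun z hz => by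
    have hb : ‖w z / z * (z₀ / w z₀)‖ ≤ 1 := by
      -- Here w(0)/0 is 0 by convention, not w'(0); only the bound is needed at this point.
      by_cases hz0 : z = 0
      · simp [hz0]
      have hS := Complex.dist_le_div_mul_dist_of_mapsTo_ball (z := z) hw
        (by rw [hw0]; exact hmaps.mono_right Metric.ball_subset_closedBall) (by simpa using hz)
      rw [hw0, dist_zero_right, dist_zero_right] at hS
      rw [norm_mul, norm_div, norm_div, h1, div_one, div_mul_eq_mul_div,
        div_le_one (norm_pos_iff.2 hz0)]
      calc ‖w z‖ * ‖z₀‖ ≤ 1 / ‖z₀‖ * ‖z‖ * ‖z₀‖ := by gcongr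
        _ = ‖z‖ := by field_simp [norm_ne_zero_iff.2 hz₀]
    have h2 := (Complex.re_le_norm _).trans hb
    simp only [Pi.neg_apply, Pi.div_apply, id, hval, Complex.neg_re, Complex.one_re]
    linarith
  have hA : z₀ * -((w' * id z₀ - w z₀ * 1) / id z₀ ^ 2 * (z₀ / w z₀)) = 1 - z₀ * w' / w z₀ := by
    simp only [id]
    field_simp
    ring
  rw [hA] at him hre
  refine ⟨(z₀ * w' / w z₀ - 1).re, by rw [← neg_sub, Complex.neg_re]; linarith, ?_⟩
  have h3 : (((z₀ * w' / w z₀ - 1).re : ℝ) : ℂ) = z₀ * w' / w z₀ - 1 := by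
    refine Complex.ext (by simp) ?_
    rw [← neg_sub, Complex.neg_im, him]
    simp
  rw [h3]
  field_simp
  ring

/-! ### The first-exit argument and the subordination -/

theorem re_div_one_sub {ζ : ℂ} (h1 : ‖ζ‖ = 1) (hne : ζ ≠ 1) : (ζ / (1 - ζ)).re = -1 / 2 := by
  have h2 : ζ.re * ζ.re + ζ.im * ζ.im = 1 := by
    rw [← Complex.normSq_apply, Complex.normSq_eq_norm_sq, h1, one_pow]
  have h3 : Complex.normSq (1 - ζ) ≠ 0 := by
    rw [Ne, Complex.normSq_eq_zero, sub_eq_zero]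
    exact hne.symm
  rw [Complex.div_re, ← add_div, div_eq_div_iff h3 two_ne_zero, Complex.normSq_apply]
  simp only [Complex.sub_re, Complex.sub_im, Complex.one_re, Complex.one_im]
  linear_combination (-1) * h2

theorem inv_mem_recipQ_image {α : ℝ} (hα0 : 0 ≤ α) (hα1 : α < 1) {p : ℂ → ℂ}
    (hp : AnalyticOnNhd ℂ p unitDisk) (hp0 : p 0 = 1) (hpos : ∀ z ∈ unitDisk, 0 < (p z).re)
    (hH : ∀ z ∈ unitDisk, α < (p z + z * deriv p z / p z).re) {z : ℂ} (hz : z ∈ unitDisk) :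
    (p z)⁻¹ ∈ recipQ α '' unitDisk := by
  by_contra hcon
  have hpne : ∀ z ∈ unitDisk, p z ≠ 0 := fun z hz h => by
    have := hpos z hz
    simp [h] at this
  have hP : ContinuousOn (fun z => (p z)⁻¹) unitDisk := hp.continuousOn.inv₀ hpne
  have hz' : ‖z‖ < 1 := by simpa [unitDisk] using hz
  have hsub : Metric.closedBall (0 : ℂ) ‖z‖ ⊆ unitDisk := Metric.closedBall_subset_ball hz'
  have hcomp : IsCompact (Metric.closedBall (0 : ℂ) ‖z‖ ∩
      (fun z => (p z)⁻¹) ⁻¹' (recipQ α '' unitDisk)ᶜ) :=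
    (isCompact_closedBall _ _).of_isClosed_subset
      ((hP.mono hsub).preimage_isClosed_of_isClosed Metric.isClosed_closedBall
        (isOpen_recipQ_image hα0 hα1).isClosed_compl) Set.inter_subset_left
  -- A point of least modulus at which 1/p lies outside the open set Q(𝔻).
  obtain ⟨z₀, ⟨hz₀, hnot⟩, hmin⟩ := hcomp.exists_isMinOn ⟨z, by simp, hcon⟩
    continuous_norm.continuousOn
  have hz₀' := hsub hz₀
  have hn : ‖z₀‖ ≤ ‖z‖ := by simpa using hz₀
  have hin : ∀ x ∈ Metric.ball (0 : ℂ) ‖z₀‖, (p x)⁻¹ ∈ recipQ α '' unitDisk := fun x hx => by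
    have hx' : ‖x‖ < ‖z₀‖ := by simpa using hx
    by_contra h
    exact absurd (hmin ⟨by simpa using hx'.le.trans hn, h⟩) (not_le.2 hx')
  have hne₀ : z₀ ≠ 0 := by
    rintro rfl
    exact hnot ⟨0, by simp [unitDisk], by simp [hp0, recipQ_zero]⟩
  have hballsub : Metric.ball (0 : ℂ) ‖z₀‖ ⊆ unitDisk :=
    Metric.ball_subset_ball (hn.trans hz'.le)
  have hclos : (p z₀)⁻¹ ∈ closure (recipQ α '' unitDisk) := by
    refine ContinuousWithinAt.mem_closure (f := fun z => (p z)⁻¹) (s := Metric.ball (0 : ℂ) ‖z₀‖)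
      ((hP z₀ hz₀').mono hballsub) ?_ hin
    rw [closure_ball _ (norm_ne_zero_iff.2 hne₀)]
    simp
  obtain ⟨ζ, hζ, hζ1, hQζ⟩ := exists_recipQ_eq_of_mem_closure hα1 hclos (inv_ne_zero (hpne _ hz₀'))
  have hnorm : ‖ζ‖ = 1 := by
    refine hζ1.eq_of_not_lt fun h => hnot ⟨ζ, by simpa [unitDisk] using h, hQζ⟩
  have hζne : ζ ≠ 1 := fun h => by simp [h, halfPlane] at hζ
  set w : ℂ → ℂ := fun z => recipQInv α (p z)⁻¹
  have hwmem : ∀ x ∈ Metric.ball (0 : ℂ) ‖z₀‖, ∃ v ∈ unitDisk, recipQ α v = (p x)⁻¹ ∧ w x = v :=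
    fun x hx => by
      obtain ⟨v, hv, hvx⟩ := hin x hx
      exact ⟨v, hv, hvx, by
        simp only [w, ← hvx, recipQInv_recipQ hα0 hα1 (unitDisk_subset_halfPlane hv)]⟩
  have hwd : ∀ x ∈ unitDisk, ∀ v ∈ halfPlane, recipQ α v = (p x)⁻¹ →
      HasDerivAt w ((deriv (recipQ α) v)⁻¹ * (-deriv p x / p x ^ 2)) x := fun x hx v hv h => by
    have h1 := hasDerivAt_recipQInv hα0 hα1 hv
    rw [h] at h1
    exact h1.comp x ((hp x hx).differentiableAt.hasDerivAt.inv (hpne x hx))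
  have hwz₀ : w z₀ = ζ := by
    simp only [w, ← hQζ, recipQInv_recipQ hα0 hα1 hζ]
  obtain ⟨k, hk, hjack⟩ := jack (w := w) (z₀ := z₀)
    (fun x hx => by
      obtain ⟨v, hv, hvx, -⟩ := hwmem x hx
      exact (hwd x (hballsub hx) v
        (unitDisk_subset_halfPlane hv) hvx).differentiableAt.differentiableWithinAt)
    (by simp only [w, hp0, inv_one, recipQInv_one hα0 hα1])
    (fun x hx => by
      obtain ⟨v, hv, -, hwv⟩ := hwmem x hx
      rw [hwv]
      exact hv)
    (hwd z₀ hz₀' ζ hζ hQζ) (by rw [hwz₀, hnorm])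
  rw [hwz₀] at hjack
  have hD := deriv_recipQ_ne_zero hα0 hα1 hζ
  have hode := recipQ_add_mul_deriv α hζ
  have hmul := mul_recipQ α ζ
  rw [extremalRatio] at hmul
  have hp₀ := hpne z₀ hz₀'
  have h1ζ := one_sub_ne_zero hζ
  -- Chain rule for 1/p = Q(w) at z₀, with ζQ'(ζ) taken from the differential equation; the right
  -- side is (1 + k)(h(ζ) - p(z₀)).
  have hX : z₀ * deriv p z₀ / p z₀ =
      ((1 + k : ℝ) : ℂ) * (1 - p z₀ + ((2 - 2 * α : ℝ) : ℂ) * (ζ / (1 - ζ))) := by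
    have hB : powPrimitive α ζ = ζ / (1 - ζ) * (p z₀)⁻¹ := by
      rw [← hQζ]
      field_simp
      linear_combination -hmul
    have h2 : z₀ * deriv p z₀ / p z₀ = -p z₀ * ((1 + k) * (ζ * deriv (recipQ α) ζ)) := by
      have h3 : (1 + k) * (ζ * deriv (recipQ α) ζ) = -(z₀ * deriv p z₀ / p z₀ ^ 2) := by
        rw [← mul_assoc, ← hjack]
        field_simp
      rw [h3]
      field_simp
    have h4 : ζ * deriv (recipQ α) ζ =
        1 - (2 - 2 * α) * (ζ / (1 - ζ) * (p z₀)⁻¹) - (p z₀)⁻¹ := by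
      rw [hB, hQζ] at hode
      linear_combination hode
    rw [h2, h4]
    push_cast
    field_simp
    ring
  have hfin := hH z₀ hz₀'
  rw [hX, Complex.add_re, Complex.re_ofReal_mul, Complex.add_re, Complex.re_ofReal_mul,
    re_div_one_sub hnorm hζne, Complex.sub_re, Complex.one_re] at hfin
  have hge := le_re_of_lt_re_add hp hpos hH hz₀'
  -- The hypothesis at z₀ now reads α < α - k(Re p(z₀) - α).
  nlinarith [mul_nonneg hk (sub_nonneg.2 hge)]

/-- A function `p` with `p(0) = 1` and `Re p > 0` satisfying `Re (p + z p'/p) > α` is subordinate to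
`q_α`, the solution of `q + z q'/q = (1 + (1 - 2α) z) / (1 - z)`. -/
theorem subordinate_q_of_lt_re_add {α : ℝ} (hα0 : 0 ≤ α) (hα1 : α < 1) {p : ℂ → ℂ}
    (hp : AnalyticOnNhd ℂ p unitDisk) (hp0 : p 0 = 1) (hpos : ∀ z ∈ unitDisk, 0 < (p z).re)
    (hH : ∀ z ∈ unitDisk, α < (p z + z * deriv p z / p z).re) : Subordinate p (q α) := by
  have hpne : ∀ z ∈ unitDisk, p z ≠ 0 := fun z hz h => by
    have := hpos z hz
    simp [h] at this
  have hmem : ∀ z ∈ unitDisk, ∃ v ∈ unitDisk,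
      recipQ α v = (p z)⁻¹ ∧ recipQInv α (p z)⁻¹ = v := fun z hz => by
    obtain ⟨v, hv, hvz⟩ := inv_mem_recipQ_image hα0 hα1 hp hp0 hpos hH hz
    exact ⟨v, hv, hvz, by rw [← hvz, recipQInv_recipQ hα0 hα1 (unitDisk_subset_halfPlane hv)]⟩
  refine ⟨hp, ?_, fun z => recipQInv α (p z)⁻¹, ⟨?_, ?_, ?_⟩, ?_⟩
  · rw [funext (q_eq_inv_recipQ α)]
    exact ((analyticOnNhd_recipQ α).mono unitDisk_subset_halfPlane).inv fun z hz =>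
      recipQ_ne_zero hα0 hα1 (unitDisk_subset_halfPlane hz)
  · refine DifferentiableOn.analyticOnNhd (fun z hz => ?_) Metric.isOpen_ball
    obtain ⟨v, hv, hvz, -⟩ := hmem z hz
    have h1 := hasDerivAt_recipQInv hα0 hα1 (unitDisk_subset_halfPlane hv)
    rw [hvz] at h1
    exact (h1.comp z ((hp z hz).differentiableAt.hasDerivAt.inv
      (hpne z hz))).differentiableAt.differentiableWithinAt
  · simp only [hp0, inv_one, recipQInv_one hα0 hα1]
  · intro z hz
    obtain ⟨v, hv, -, hvz⟩ := hmem z hz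
    simpa only [hvz] using hv
  · intro z hz
    obtain ⟨v, hv, hvz, hv'⟩ := hmem z hz
    simp only [q_eq_inv_recipQ, hv', hvz, inv_inv]

/-! ### The quotient zf'/f and the conclusion -/

theorem logDerivQuotient_zero (f : ℂ → ℂ) : logDerivQuotient f 0 = 1 := by
  simp [logDerivQuotient]

theorem ne_zero_of_mem_classS {f : ℂ → ℂ} (hf : f ∈ classS) {z : ℂ} (hz : z ∈ unitDisk)
    (h0 : z ≠ 0) : f z ≠ 0 := fun h =>
  h0 (hf.2.2.2 hz (by simp [unitDisk]) (h.trans hf.2.1.symm))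

/-- On the disk the quotient equals f' divided by the zero-free analytic function f(z)/z, which
removes the singularity at 0. -/
theorem analyticOnNhd_logDerivQuotient {f : ℂ → ℂ} (hf : f ∈ classS) :
    AnalyticOnNhd ℂ (logDerivQuotient f) unitDisk := by
  have h0 : unitDisk ∈ 𝓝 (0 : ℂ) := Metric.ball_mem_nhds _ one_pos
  have hd : AnalyticOnNhd ℂ (dslope f 0) unitDisk :=
    ((Complex.differentiableOn_dslope h0).2 hf.1.differentiableOn).analyticOnNhd
      Metric.isOpen_ball
  have hmul : ∀ z, z * dslope f 0 z = f z := fun z => by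
    simpa [hf.2.1] using sub_smul_dslope f 0 z
  have hne : ∀ z ∈ unitDisk, dslope f 0 z ≠ 0 := fun z hz h => by
    by_cases hz0 : z = 0
    · rw [hz0, dslope_same, hf.2.2.1] at h
      exact one_ne_zero h
    · exact ne_zero_of_mem_classS hf hz hz0 (by rw [← hmul, h, mul_zero])
  refine (hf.1.deriv.div hd hne).congr Metric.isOpen_ball fun z hz => ?_
  by_cases hz0 : z = 0
  · simp [hz0, logDerivQuotient, hf.2.2.1]
  · have := hne z hz
    rw [logDerivQuotient, if_neg hz0, ← hmul z]
    field_simp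

theorem mul_deriv_logDerivQuotient {f : ℂ → ℂ} (hf : f ∈ classS) {z : ℂ} (hz : z ∈ unitDisk)
    (hp : logDerivQuotient f z ≠ 0) :
    z * deriv (logDerivQuotient f) z / logDerivQuotient f z =
      1 + z * deriv (deriv f) z / deriv f z - logDerivQuotient f z := by
  by_cases hz0 : z = 0
  · simp [hz0, logDerivQuotient_zero]
  have hfz := ne_zero_of_mem_classS hf hz hz0
  have hval : logDerivQuotient f z = z * deriv f z / f z := by rw [logDerivQuotient, if_neg hz0]
  have hf' : deriv f z ≠ 0 := fun h => hp (by rw [hval, h, mul_zero, zero_div])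
  have h1 := ((hasDerivAt_id z).mul (hf.1 z hz).deriv.differentiableAt.hasDerivAt).div
    (hf.1 z hz).differentiableAt.hasDerivAt hfz
  have h2 : logDerivQuotient f =ᶠ[𝓝 z] (id * deriv f) / f := by
    filter_upwards [isOpen_ne.mem_nhds hz0] with x hx
    rw [logDerivQuotient, if_neg hx]
    rfl
  rw [(h1.congr_of_eventuallyEq h2).deriv, hval]
  simp only [Pi.mul_apply, id]
  field_simp

theorem subordinate_of_mem_classSq {α : ℝ} (hα0 : 0 ≤ α) (hα1 : α < 1) {f : ℂ → ℂ}
    (hf : f ∈ classSq α) : Subordinate (logDerivQuotient f) (q α) := by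
  have hpos : ∀ z ∈ unitDisk, 0 < (logDerivQuotient f z).re := fun z hz =>
    (norm_nonneg _).trans_lt (hf.2 z hz)
  refine subordinate_q_of_lt_re_add hα0 hα1 (analyticOnNhd_logDerivQuotient hf.1)
    (logDerivQuotient_zero f) hpos fun z hz => ?_
  have hne : logDerivQuotient f z ≠ 0 := fun h => by
    have := hpos z hz
    simp [h] at this
  have h1 := hf.2 z hz
  rw [← mul_deriv_logDerivQuotient hf.1 hz hne] at h1
  -- Only α - Re(zp'/p) ≤ |zp'/p - α| < Re p is used.
  have h2 := (neg_le_abs _).trans (Complex.abs_re_le_norm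
    (z * deriv (logDerivQuotient f) z / logDerivQuotient f z - (α : ℂ)))
  rw [Complex.sub_re, Complex.ofReal_re] at h2
  rw [Complex.add_re]
  linarith

end StarlikeSubordination

theorem mainTheorem1 (α : ℝ) (hα0 : 0 ≤ α) (hα1 : α < 1) :
    (∀ f ∈ StarlikeSubordination.classSq α,
      StarlikeSubordination.Subordinate (StarlikeSubordination.logDerivQuotient f)
        (StarlikeSubordination.q α)) ∧
    StarlikeSubordination.classSq α ⊆
      StarlikeSubordination.classStar (StarlikeSubordination.q α) :=
  ⟨fun _ hf => StarlikeSubordination.subordinate_of_mem_classSq hα0 hα1 hf,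
    fun _ hf => ⟨hf.1, StarlikeSubordination.subordinate_of_mem_classSq hα0 hα1 hf⟩⟩
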